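/- A word $u$ is an interleaving of words $w$ and $v$ if the positions of $u$ can be split into two disjoint sets, on which $u$ reads $w$ and $v$ respectively; $w\,\|\,v$ is the set of all interleavings, and $L\,\|\,K=\bigcup_{w\in L,\,v\in K} w\,\|\,v$ for languages $L,K$. **trPCCFL.** A *partially-commutative context-free grammar* over a finite alphabet consists of a finite set $V$ of non-terminals, an initial non-terminal $S\in V$, finitely many productions $X\xrightarrow{a}\alpha$ (with $X\in V$, $a$ a letter, $\alpha\in V^*$), and a symmetric irreflexive independence relation $I\subseteq V\times V$; its complement $D=(V\times V)\setminus I$ is the dependence relation. Its steps on configurations in $V^*$ are $X\beta\xrightarrow{a}\alpha\beta$ for a production $X\xrightarrow{a}\alpha$, and the unlabelled swaps $\alpha XY\beta\to\alpha YX\beta$ for $(X,Y)\in I$. The generated language is the set of words read along finite sequences of steps from $S$ to $\varepsilon$. $\mathrm{trPCCFL}$ is the class of languages generated by such grammars whose dependence relation $D$ is transitive. **shuffle-CFL.** A *PA grammar* over a finite alphabet consists of a finite set of non-terminals, an initial non-terminal $S$, and finitely many productions $X\xrightarrow{a}t$, with $a$ a letter and $t$ a term built from non-terminals and the empty term $\varepsilon$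 by sequential composition $;$ and parallel composition $\|$. Terms are taken up to the least congruence that makes both operations associative with neutral element $\varepsilon$, and $\|$ commutative. The steps are the least relation containing all productions such that $t\xrightarrow{a}t'$ implies $t;u\xrightarrow{a}t';u$, $\ t\,\|\,u\xrightarrow{a}t'\,\|\,u$ and $u\,\|\,t\xrightarrow{a}u\,\|\,t'$. The generated language is the set of words read along sequences of steps from $S$ to $\varepsilon$. $\text{shuffle-CFL}$ is the class of languages generated by PA grammars. **trace-CFL.** Given a symmetric irreflexive relation on the letters of a finite alphabet, two words are trace equivalent if one can be transformed into the other by swaps of neighbouring related letters. The trace closure of a language $L$ is the set of words that are trace equivalent to some word of $L$. $\text{trace-CFL}$ is the class of trace closures of context-free languages. **Theorem.** 1. $\mathrm{trPCCFL}\cap\text{shuffle-CFL}\not\subseteq\text{trace-CFL}$. 2. $\mathrm{trPCCFL}\cap\text{trace-CFL}\not\subseteq\text{shuffle-CFL}$. This is witnessed by the language $$L_3=\bigcup_{n\ge 0}a^n\,s\,(b^n\,\|\,c^n)$$ over the alphabet $\{a,b,c,s\}$: $L_3$ belongs to $\mathrm{trPCCFL}$ and to $\text{trace-CFL}$, but not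 to $\text{shuffle-CFL}$. -/

import Mathlib

/-! Partially-commutative context-free grammars, process-algebra grammars, trace closures of
context-free languages, and the three classes of languages they define. -/

namespace PartialComm

/-- `Interleaving u v w`: the word `w` is an interleaving of `u` and `v`, i.e. `w ∈ u ‖ v`. -/
inductive Interleaving {T : Type} : List T → List T → List T → Prop
  | nil : Interleaving [] [] []
  | left (x : T) {u v w : List T} : Interleaving u v w → Interleaving (x :: u) v (x :: w)
  | right (x : T) {u v w : List T} : Interleaving u v w → Interleaving u (x :: v) (x :: w)

/-- A finite sequence of steps, each labelled by a word, from one configuration to another one,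
together with the concatenation of the labels. -/
inductive Derives {T C : Type} (step : C → List T → C → Prop) : C → List T → C → Prop
  | nil (c : C) : Derives step c [] c
  | cons {c d e : C} {u v : List T} :
      step c u d → Derives step d v e → Derives step c (u ++ v) e

/-- A Greibach context-free grammar over the alphabet `T`, equipped with a symmetric and
irreflexive independence relation on its non-terminals. A production `X →ᵃ α` is the triple
`(X, a, α)`. -/
structure PCGrammar (T : Type) where
  NT : Type
  finite_NT : Finite NT
  initial : NT
  productions : Set (NT × T × List NT)
  finite_productions : productions.Finite
  Indep : NT → NT → Prop
  indep_symm : ∀ X Y, Indep X Y → Indep Y X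
  indep_irrefl : ∀ X, ¬ Indep X X

namespace PCGrammar

variable {T : Type} (G : PCGrammar T)

/-- The dependence relation: the complement of independence. -/
def Dep (X Y : G.NT) : Prop := ¬ G.Indep X Y

/-- The dependence relation is transitive. -/
def TransitiveDependence : Prop := ∀ X Y Z, G.Dep X Y → G.Dep Y Z → G.Dep X Z

/-- Steps between configurations. A production step is labelled by its letter,
a swap step by the empty word. -/
inductive Step : List G.NT → List T → List G.NT → Prop
  | production {X : G.NT} {a : T} {α : List G.NT} (β : List G.NT) :
      (X, a, α) ∈ G.productions → Step (X :: β) [a] (α ++ β)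
  | swap {X Y : G.NT} (α β : List G.NT) :
      G.Indep X Y → Step (α ++ X :: Y :: β) [] (α ++ Y :: X :: β)

/-- The set of words generated by the initial non-terminal. -/
def language : Language T := {w | Derives G.Step [G.initial] w []}

end PCGrammar

/-- Terms built from non-terminals and the empty term by sequential and parallel composition. -/
inductive PATerm (V : Type) : Type
  | empty : PATerm V
  | var : V → PATerm V
  | seq : PATerm V → PATerm V → PATerm V
  | par : PATerm V → PATerm V → PATerm V

/-- Structural equivalence of terms: the least congruence for which both compositions are
associative with neutral element the empty term, and parallel composition is commutative. -/
inductive StructEquiv {V : Type} : PATerm V → PATerm V → Prop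
  | refl (t : PATerm V) : StructEquiv t t
  | symm {t u : PATerm V} : StructEquiv t u → StructEquiv u t
  | trans {t u v : PATerm V} : StructEquiv t u → StructEquiv u v → StructEquiv t v
  | seq_congr {t t' u u' : PATerm V} :
      StructEquiv t t' → StructEquiv u u' → StructEquiv (.seq t u) (.seq t' u')
  | par_congr {t t' u u' : PATerm V} :
      StructEquiv t t' → StructEquiv u u' → StructEquiv (.par t u) (.par t' u')
  | seq_assoc (t u v : PATerm V) : StructEquiv (.seq (.seq t u) v) (.seq t (.seq u v))
  | par_assoc (t u v : PATerm V) : StructEquiv (.par (.par t u) v) (.par t (.par u v))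
  | par_comm (t u : PATerm V) : StructEquiv (.par t u) (.par u t)
  | empty_seq (t : PATerm V) : StructEquiv (.seq .empty t) t
  | seq_empty (t : PATerm V) : StructEquiv (.seq t .empty) t
  | empty_par (t : PATerm V) : StructEquiv (.par .empty t) t
  | par_empty (t : PATerm V) : StructEquiv (.par t .empty) t

/-- A process-algebra (PA) grammar over the alphabet `T`. A production `X →ᵃ t` is the triple
`(X, a, t)`. -/
structure PAGrammar (T : Type) where
  NT : Type
  finite_NT : Finite NT
  initial : NT
  productions : Set (NT × T × PATerm NT)
  finite_productions : productions.Finite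

namespace PAGrammar

variable {T : Type} (G : PAGrammar T)

/-- Steps between terms, each labelled by a letter. The rule `struct` expresses that terms are
considered up to structural equivalence. -/
inductive Step : PATerm G.NT → T → PATerm G.NT → Prop
  | production {X : G.NT} {a : T} {t : PATerm G.NT} :
      (X, a, t) ∈ G.productions → Step (.var X) a t
  | seq {t t' : PATerm G.NT} {a : T} (u : PATerm G.NT) :
      Step t a t' → Step (.seq t u) a (.seq t' u)
  | par_left {t t' : PATerm G.NT} {a : T} (u : PATerm G.NT) :
      Step t a t' → Step (.par t u) a (.par t' u)
  | par_right {u u' : PATerm G.NT} {a : T} (t : PATerm G.NT) :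
      Step u a u' → Step (.par t u) a (.par t u')
  | struct {t t' u u' : PATerm G.NT} {a : T} :
      StructEquiv t t' → Step t' a u' → StructEquiv u' u → Step t a u

/-- The set of words defined by derivations from the initial non-terminal to the empty term. -/
def language : Language T :=
  {w | Derives (fun t u t' => ∃ a, u = [a] ∧ G.Step t a t') (.var G.initial) w .empty}

end PAGrammar

/-- One word is obtained from the other by swapping two neighbouring independent letters. -/
inductive LetterSwap {T : Type} (I : T → T → Prop) : List T → List T → Prop
  | swap {a b : T} (u v : List T) : I a b → LetterSwap I (u ++ a :: b :: v) (u ++ b :: a :: v)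

/-- One word may be transformed into the other by swaps of neighbouring independent letters. -/
def TraceEquiv {T : Type} (I : T → T → Prop) : List T → List T → Prop :=
  Relation.ReflTransGen (LetterSwap I)

/-- The trace closure of a language. -/
def traceClosure {T : Type} (I : T → T → Prop) (L : Language T) : Language T :=
  {w | ∃ v ∈ L, TraceEquiv I w v}

/-- The class trPCCFL, over the alphabet `T`: languages of partially-commutative context-free
grammars with a transitive dependence relation. -/
def TrPCCFL (T : Type) : Set (Language T) :=
  {L | ∃ G : PCGrammar T, G.TransitiveDependence ∧ G.language = L}

/-- The class shuffle-CFL, over the alphabet `T`: languages of PA grammars. -/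
def ShuffleCFL (T : Type) : Set (Language T) :=
  {L | ∃ G : PAGrammar T, G.language = L}

/-- The class trace-CFL, over the alphabet `T`: trace closures of context-free languages with
respect to independence relations on letters. -/
def TraceCFL (T : Type) : Set (Language T) :=
  {L | ∃ I : T → T → Prop, (∀ a b, I a b → I b a) ∧ (∀ a, ¬ I a a) ∧
    ∃ K : Language T, K.IsContextFree ∧ traceClosure I K = L}

/-- The four-letter alphabet `{a, b, c, s}`. -/
inductive Letter : Type
  | a
  | b
  | c
  | s

/-- The language `⋃ₙ aⁿ s (bⁿ ‖ cⁿ)`, with `n ≥ 0`. -/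
def L₃ : Language Letter :=
  {w | ∃ (n : ℕ) (v : List Letter),
    Interleaving (List.replicate n Letter.b) (List.replicate n Letter.c) v ∧
    w = List.replicate n Letter.a ++ Letter.s :: v}

end PartialComm

/-! Every word of the two witness languages contains equally many letters a, b and c. If a part of a
derivation (a subterm, or a suffix of a right-hand side) always yields a balanced word in some fixed
context, then all words it generates have the same differences of letter counts, and these are
bounded by the length of any one of them. A grammar has finitely many parts, so a single D serves
them all (`exists_nearlyBalanced`). This takes the place of a pumping lemma.

`L₃` is not in shuffle-CFL: a D-nearly balanced factor of aⁿ s bⁿ cⁿ that contains s has at most 2D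
or at least n - D letters a (`count_a_of_factor`). Along the path of the derivation tree that leads
to s, a production adds at most one a and a sequential node at most D. A parallel node adds none:
letters generated beside s could be placed on either side of it, so there are none. For large n the
gap is never crossed (`count_a_le_of_gen`).

The first part is witnessed by `shuffledABC`. It contains abc but neither bac nor acb, so an
independence relation under which it is closed relates neither a, b nor b, c. Hence aⁿ bⁿ cⁿ is
alone in its trace class and would belong to the context-free language itself, all of whose words
are balanced. But a nearly balanced factor of aⁿ bⁿ cⁿ shorter than n misses a or c and so has
length at most 3D, and joining two such factors does not reach n (`length_le_of_gen`).

The memberships come from explicit grammars whose configurations are controlled by the numbers of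
their non-terminals. -/

open List

namespace PartialComm

/-! ### Interleavings of words -/

namespace Interleaving

variable {T : Type}

theorem symm {u v w : List T} (h : Interleaving u v w) : Interleaving v u w := by
  induction h with
  | nil => exact .nil
  | left x _ ih => exact .right x ih
  | right x _ ih => exact .left x ih

theorem nil_left (v : List T) : Interleaving [] v v := by
  induction v with
  | nil => exact .nil
  | cons x v ih => exact .right x ih

theorem nil_right (u : List T) : Interleaving u [] u := (nil_left u).symm

theorem eq_of_nil_left {v w : List T} (h : Interleaving [] v w) : w = v := by
  generalize hu : ([] : List T) = u at h
  induction h with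
  | nil => rfl
  | left x _ _ => cases hu
  | right x _ ih => rw [ih hu]

theorem eq_of_nil_right {u w : List T} (h : Interleaving u [] w) : w = u :=
  eq_of_nil_left h.symm

theorem append (u v : List T) : Interleaving u v (u ++ v) := by
  induction u with
  | nil => exact nil_left v
  | cons x u ih => exact .left x ih

theorem assoc {u v w x y : List T} (h : Interleaving x w y) (h' : Interleaving u v x) :
    ∃ z, Interleaving v w z ∧ Interleaving u z y := by
  induction h generalizing u v with
  | nil => cases h'; exact ⟨[], .nil, .nil⟩
  | left a _ ih =>
    cases h' with
    | left _ h' => obtain ⟨z, h₁, h₂⟩ := ih h'; exact ⟨z, h₁, .left a h₂⟩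
    | right _ h' => obtain ⟨z, h₁, h₂⟩ := ih h'; exact ⟨a :: z, .left a h₁, .right a h₂⟩
  | right a _ ih => obtain ⟨z, h₁, h₂⟩ := ih h'; exact ⟨a :: z, .right a h₁, .right a h₂⟩

theorem perm {u v w : List T} (h : Interleaving u v w) : w.Perm (u ++ v) := by
  induction h with
  | nil => rfl
  | left x _ ih => exact ih.cons x
  | right x _ ih => exact (ih.cons x).trans List.perm_middle.symm

end Interleaving

/-! ### Compositional semantics of PA terms -/

namespace PAGrammar

variable {T : Type} (G : PAGrammar T)

/-- The words that can be read along steps from a term to the empty term, described by recursion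
on the term. -/
inductive Gen : PATerm G.NT → List T → Prop
  | empty : Gen .empty []
  | var {X : G.NT} {a : T} {t : PATerm G.NT} {w : List T} :
      (X, a, t) ∈ G.productions → Gen t w → Gen (.var X) (a :: w)
  | seq {t u : PATerm G.NT} {v w : List T} : Gen t v → Gen u w → Gen (.seq t u) (v ++ w)
  | par {t u : PATerm G.NT} {v w x : List T} :
      Gen t v → Gen u w → Interleaving v w x → Gen (.par t u) x

variable {G}

theorem gen_empty_iff {w : List T} : G.Gen .empty w ↔ w = [] :=
  ⟨fun h => by cases h; rfl, fun h => h ▸ .empty⟩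

theorem gen_seq_iff {t u : PATerm G.NT} {x : List T} :
    G.Gen (.seq t u) x ↔ ∃ v w, G.Gen t v ∧ G.Gen u w ∧ v ++ w = x := by
  constructor
  · rintro (_ | _ | ⟨h₁, h₂⟩)
    exact ⟨_, _, h₁, h₂, rfl⟩
  · rintro ⟨v, w, h₁, h₂, rfl⟩
    exact .seq h₁ h₂

theorem gen_par_iff {t u : PATerm G.NT} {x : List T} :
    G.Gen (.par t u) x ↔ ∃ v w, G.Gen t v ∧ G.Gen u w ∧ Interleaving v w x := by
  constructor
  · rintro (_ | _ | _ | ⟨h₁, h₂, h₃⟩)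
    exact ⟨_, _, h₁, h₂, h₃⟩
  · rintro ⟨v, w, h₁, h₂, h₃⟩
    exact .par h₁ h₂ h₃

theorem Gen.par_symm {t u : PATerm G.NT} {x : List T} (h : G.Gen (.par t u) x) :
    G.Gen (.par u t) x := by
  obtain ⟨v, w, h₁, h₂, h₃⟩ := gen_par_iff.1 h
  exact .par h₂ h₁ h₃.symm

theorem Gen.par_assoc {t u v : PATerm G.NT} {x : List T} (h : G.Gen (.par (.par t u) v) x) :
    G.Gen (.par t (.par u v)) x := by
  obtain ⟨_, _, h₁, h₂, h₃⟩ := gen_par_iff.1 h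
  obtain ⟨_, _, h₄, h₅, h₆⟩ := gen_par_iff.1 h₁
  obtain ⟨_, h₇, h₈⟩ := h₃.assoc h₆
  exact .par h₄ (.par h₅ h₂ h₇) h₈

/-- Concatenation and interleaving of languages satisfy the laws imposed on the two compositions.
This is what lets the rule `struct` disappear from the recursive description. -/
theorem gen_congr {t u : PATerm G.NT} (h : StructEquiv t u) (w : List T) :
    G.Gen t w ↔ G.Gen u w := by
  induction h generalizing w with
  | refl t => rfl
  | symm _ ih => exact (ih w).symm
  | trans _ _ ih₁ ih₂ => exact (ih₁ w).trans (ih₂ w)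
  | seq_congr _ _ ih₁ ih₂ => simp only [gen_seq_iff, ih₁, ih₂]
  | par_congr _ _ ih₁ ih₂ => simp only [gen_par_iff, ih₁, ih₂]
  | seq_assoc t u v =>
    simp only [gen_seq_iff]
    constructor
    · rintro ⟨_, w₃, ⟨w₁, w₂, h₁, h₂, rfl⟩, h₃, rfl⟩
      exact ⟨w₁, _, h₁, ⟨w₂, w₃, h₂, h₃, rfl⟩, (List.append_assoc ..).symm⟩
    · rintro ⟨w₁, _, h₁, ⟨w₂, w₃, h₂, h₃, rfl⟩, rfl⟩
      exact ⟨_, w₃, ⟨w₁, w₂, h₁, h₂, rfl⟩, h₃, List.append_assoc ..⟩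
  | par_assoc t u v =>
    -- By commutativity, the converse follows from two rotations in the direction already known.
    exact ⟨Gen.par_assoc, fun h => h.par_symm.par_assoc.par_symm.par_assoc.par_symm⟩
  | par_comm t u => exact ⟨Gen.par_symm, Gen.par_symm⟩
  | empty_seq t => simp [gen_seq_iff, gen_empty_iff]
  | seq_empty t => simp [gen_seq_iff, gen_empty_iff]
  | empty_par t =>
    refine ⟨fun h => ?_, fun h => .par .empty h (.nil_left w)⟩
    obtain ⟨_, _, h₁, h₂, h₃⟩ := gen_par_iff.1 h
    cases gen_empty_iff.1 h₁
    exact h₃.eq_of_nil_left ▸ h₂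
  | par_empty t =>
    refine ⟨fun h => ?_, fun h => .par h .empty (.nil_right w)⟩
    obtain ⟨_, _, h₁, h₂, h₃⟩ := gen_par_iff.1 h
    cases gen_empty_iff.1 h₂
    exact h₃.eq_of_nil_right ▸ h₁

theorem Step.gen_cons {t t' : PATerm G.NT} {a : T} (h : G.Step t a t') {w : List T}
    (hw : G.Gen t' w) : G.Gen t (a :: w) := by
  induction h generalizing w with
  | production h => exact .var h hw
  | seq u _ ih =>
    obtain ⟨_, _, h₁, h₂, rfl⟩ := gen_seq_iff.1 hw
    exact .seq (ih h₁) h₂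
  | par_left u _ ih =>
    obtain ⟨_, _, h₁, h₂, h₃⟩ := gen_par_iff.1 hw
    exact .par (ih h₁) h₂ (.left _ h₃)
  | par_right t _ ih =>
    obtain ⟨_, _, h₁, h₂, h₃⟩ := gen_par_iff.1 hw
    exact .par h₁ (ih h₂) (.right _ h₃)
  | struct h₁ _ h₂ ih => exact (gen_congr h₁ _).2 (ih ((gen_congr h₂ _).2 hw))

theorem Gen.structEquiv_empty {t : PATerm G.NT} {w : List T} (h : G.Gen t w) (hw : w = []) :
    StructEquiv t .empty := by
  induction h with
  | empty => exact .refl _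
  | var _ _ _ => cases hw
  | seq _ _ ih₁ ih₂ =>
    obtain ⟨h₁, h₂⟩ := List.append_eq_nil_iff.1 hw
    exact (StructEquiv.seq_congr (ih₁ h₁) (ih₂ h₂)).trans (.empty_seq _)
  | par _ _ h ih₁ ih₂ =>
    subst hw
    cases h
    exact (StructEquiv.par_congr (ih₁ rfl) (ih₂ rfl)).trans (.empty_par _)

theorem Gen.exists_step {t : PATerm G.NT} {a : T} {x w : List T} (h : G.Gen t x)
    (hx : x = a :: w) : ∃ t', G.Step t a t' ∧ G.Gen t' w := by
  induction h generalizing w with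
  | empty => cases hx
  | var h₁ h₂ _ => cases hx; exact ⟨_, .production h₁, h₂⟩
  | @seq t u v v' h₁ h₂ ih₁ ih₂ =>
    cases v with
    | nil =>
      obtain ⟨u', h₃, h₄⟩ := ih₂ hx
      -- Only the first factor of a sequential composition may move, so a first factor that reads
      -- nothing has to be erased by structural equivalence.
      exact ⟨u', .struct ((StructEquiv.seq_congr (h₁.structEquiv_empty rfl) (.refl u)).trans
        (.empty_seq u)) h₃ (.refl u'), h₄⟩
    | cons b v =>
      cases hx
      obtain ⟨t', h₃, h₄⟩ := ih₁ rfl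
      exact ⟨_, .seq u h₃, .seq h₄ h₂⟩
  | @par t u _ _ _ h₁ h₂ h ih₁ ih₂ =>
    subst hx
    cases h with
    | left _ h =>
      obtain ⟨t', h₃, h₄⟩ := ih₁ rfl
      exact ⟨_, .par_left u h₃, .par h₄ h₂ h⟩
    | right _ h =>
      obtain ⟨u', h₃, h₄⟩ := ih₂ rfl
      exact ⟨_, .par_right t h₃, .par h₁ h₄ h⟩

/-- The empty word is excluded because `Derives` must end in `.empty` itself: a term merely
equivalent to it has no step reading nothing. For other words the last step absorbs the equivalence.
-/
theorem Gen.derives {t : PATerm G.NT} {w : List T} (h : G.Gen t w) (hw : w ≠ []) :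
    Derives (fun t u t' => ∃ a, u = [a] ∧ G.Step t a t') t w .empty := by
  induction w generalizing t with
  | nil => exact absurd rfl hw
  | cons a w ih =>
    obtain ⟨t', h₁, h₂⟩ := h.exists_step rfl
    cases w with
    | nil =>
      exact .cons (u := [a]) ⟨a, rfl, .struct (.refl t) h₁ (h₂.structEquiv_empty rfl)⟩ (.nil _)
    | cons b w => exact .cons (u := [a]) ⟨a, rfl, h₁⟩ (ih h₂ (List.cons_ne_nil b w))

theorem gen_of_derives {t t' : PATerm G.NT} {w : List T}
    (h : Derives (fun t u t' => ∃ a, u = [a] ∧ G.Step t a t') t w t') (ht : t' = .empty) :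
    G.Gen t w := by
  induction h with
  | nil c => exact ht ▸ .empty
  | cons h _ ih =>
    obtain ⟨a, rfl, h⟩ := h
    exact h.gen_cons (ih ht)

theorem mem_language_iff {w : List T} : w ∈ G.language ↔ G.Gen (.var G.initial) w := by
  refine ⟨fun h => gen_of_derives h rfl, fun h => h.derives ?_⟩
  cases h
  exact List.cons_ne_nil _ _

end PAGrammar

/-! ### Letter counts and uniform near-balance -/

instance : DecidableEq Letter := fun x y => by
  cases x <;> cases y <;> first | exact isTrue rfl | exact isFalse (by rintro ⟨⟩)

instance : Finite Letter :=
  Finite.of_surjective (fun i : Fin 4 => [Letter.a, .b, .c, .s].get i) fun x => by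
    cases x
    exacts [⟨0, rfl⟩, ⟨1, rfl⟩, ⟨2, rfl⟩, ⟨3, rfl⟩]

theorem Interleaving.count_eq {T : Type} [DecidableEq T] {u v w : List T}
    (h : Interleaving u v w) (x : T) : w.count x = u.count x + v.count x := by
  rw [h.perm.count_eq, List.count_append]

/-- The letters `a`, `b` and `c` occur equally often. -/
def Balanced (w : List Letter) : Prop := w.count .a = w.count .b ∧ w.count .b = w.count .c

/-- The numbers of occurrences of `a` and `b` differ by at most `D`, and so do those of
`b` and `c`. -/
def NearlyBalanced (D : ℕ) (w : List Letter) : Prop :=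
  (w.count .a ≤ w.count .b + D ∧ w.count .b ≤ w.count .a + D) ∧
    w.count .b ≤ w.count .c + D ∧ w.count .c ≤ w.count .b + D

theorem NearlyBalanced.mono {D E : ℕ} (h : D ≤ E) {w : List Letter} (hw : NearlyBalanced D w) :
    NearlyBalanced E w := by
  unfold NearlyBalanced at *
  omega

/-- If the words of finitely many languages can only be used in contexts which make them
balanced, then they are uniformly nearly balanced. -/
theorem exists_nearlyBalanced {ι : Type*} {F : Set ι} (hF : F.Finite)
    (L : ι → List Letter → Prop) :
    ∃ D, ∀ i ∈ F, ∀ p q, (∀ w, L i w → Balanced (p ++ w ++ q)) →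
      ∀ w, L i w → NearlyBalanced D w := by
  have key (i : ι) : ∃ D, ∀ p q, (∀ w, L i w → Balanced (p ++ w ++ q)) →
      ∀ w, L i w → NearlyBalanced D w := by
    by_cases h : ∃ v, L i v
    · obtain ⟨v, hv⟩ := h
      -- The context fixes the differences of counts, so `w` has the same ones as `v`. The bound
      -- `v.length` does not depend on the context.
      refine ⟨v.length, fun p q hpq w hw => ?_⟩
      have h₁ := hpq v hv
      have h₂ := hpq w hw
      have ha := v.count_le_length (a := Letter.a)
      have hb := v.count_le_length (a := Letter.b)
      have hc := v.count_le_length (a := Letter.c)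
      simp only [Balanced, List.count_append] at h₁ h₂
      unfold NearlyBalanced
      omega
    · exact ⟨0, fun p q _ w hw => absurd ⟨w, hw⟩ h⟩
  choose D hD using key
  exact ⟨hF.toFinset.sup D, fun i hi p q hpq w hw =>
    (hD i p q hpq w hw).mono (Finset.le_sup (hF.mem_toFinset.2 hi))⟩

theorem eq_of_append_cons_s_eq {n : ℕ} {v x y : List Letter} (hv : Letter.s ∉ v)
    (h : x ++ .s :: y = replicate n .a ++ .s :: v) : x = replicate n .a ∧ y = v := by
  have h₁ : Letter.s ∉ replicate n Letter.a := by simp [mem_replicate]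
  have h₂ := (append_cons_inj_of_notMem h₁ hv).1 h.symm
  exact ⟨h₂.1.symm, h₂.2.2.symm⟩

theorem mem_of_append_cons_s_mem_L₃ {x y : List Letter} (h : x ++ .s :: y ∈ L₃) :
    (∀ l ∈ x, l = .a) ∧ ∀ l ∈ y, l = .b ∨ l = .c := by
  obtain ⟨n, v, hv, h⟩ := h
  have h₁ : ∀ l ∈ v, l = .b ∨ l = .c := fun l hl => by
    exact (mem_append.1 (hv.perm.mem_iff.1 hl)).imp eq_of_mem_replicate eq_of_mem_replicate
  obtain ⟨rfl, rfl⟩ := eq_of_append_cons_s_eq (fun h => by simpa using h₁ _ h) h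
  exact ⟨fun l hl => eq_of_mem_replicate hl, h₁⟩

theorem balanced_of_mem_L₃ {w : List Letter} (h : w ∈ L₃) : Balanced w := by
  obtain ⟨n, v, hv, rfl⟩ := h
  simp [Balanced, count_append, hv.count_eq, count_replicate]

/-- A factor of `aⁿ s bⁿ cⁿ` which contains `s` and is nearly balanced has few or almost all
of the letters `a`. -/
theorem count_a_of_factor {n D : ℕ} {p q w : List Letter}
    (h : p ++ w ++ q = replicate n .a ++ .s :: (replicate n .b ++ replicate n .c))
    (hs : Letter.s ∈ w) (hw : NearlyBalanced D w) :
    w.count .a ≤ 2 * D ∨ n ≤ w.count .a + D := by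
  obtain ⟨x, y, rfl⟩ := append_of_mem hs
  have h' : (p ++ x) ++ .s :: (y ++ q) =
      replicate n Letter.a ++ .s :: (replicate n .b ++ replicate n .c) := by simpa using h
  obtain ⟨hx, hy⟩ := eq_of_append_cons_s_eq (by simp [mem_replicate]) h'
  have hx' : x.count .b = 0 ∧ x.count .c = 0 := by
    constructor <;> refine count_eq_zero.2 fun hl => ?_ <;>
      cases eq_of_mem_replicate (hx ▸ mem_append_right p hl)
  simp only [NearlyBalanced, count_append, count_cons, hx'] at hw ⊢
  -- Either `y` stops within the block of letters b and has no c, which makes b and then a rare, or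
  -- it contains all n letters b, which forces many a.
  rcases append_eq_append_iff.1 hy with ⟨r, hr, _⟩ | ⟨r, rfl, _⟩
  · have hc : y.count .c = 0 := count_eq_zero.2 fun hl => by
      cases eq_of_mem_replicate (hr ▸ mem_append_left r hl)
    simp [hc] at hw ⊢
    omega
  · simp [count_append, count_replicate] at hw ⊢
    omega

/-! ### Finiteness of the set of subterms of a PA grammar -/

/-- The set of subterms of a term. -/
def PATerm.subterms {V : Type} : PATerm V → Set (PATerm V)
  | .empty => {.empty}
  | .var X => {.var X}
  | .seq t u => {.seq t u} ∪ (t.subterms ∪ u.subterms)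
  | .par t u => {.par t u} ∪ (t.subterms ∪ u.subterms)

namespace PATerm

variable {V : Type}

theorem finite_subterms (t : PATerm V) : t.subterms.Finite := by
  induction t with
  | empty => exact Set.finite_singleton _
  | var X => exact Set.finite_singleton _
  | seq t u ht hu => exact (Set.finite_singleton _).union (ht.union hu)
  | par t u ht hu => exact (Set.finite_singleton _).union (ht.union hu)

theorem mem_subterms_self (t : PATerm V) : t ∈ t.subterms := by
  cases t <;> simp [subterms]

theorem mem_subterms_of_seq {t u v : PATerm V} (h : .seq t u ∈ v.subterms) :
    t ∈ v.subterms ∧ u ∈ v.subterms := by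
  induction v with
  | empty => simp [subterms] at h
  | var X => simp [subterms] at h
  | seq v₁ v₂ ih₁ ih₂ =>
    have := t.mem_subterms_self
    have := u.mem_subterms_self
    simp only [subterms, Set.mem_union, Set.mem_singleton_iff, seq.injEq] at h ⊢
    grind
  | par v₁ v₂ ih₁ ih₂ =>
    simp only [subterms, Set.mem_union, Set.mem_singleton_iff, reduceCtorEq] at h ⊢
    grind

theorem mem_subterms_of_par {t u v : PATerm V} (h : .par t u ∈ v.subterms) :
    t ∈ v.subterms ∧ u ∈ v.subterms := by
  induction v with
  | empty => simp [subterms] at h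
  | var X => simp [subterms] at h
  | seq v₁ v₂ ih₁ ih₂ =>
    simp only [subterms, Set.mem_union, Set.mem_singleton_iff, reduceCtorEq] at h ⊢
    grind
  | par v₁ v₂ ih₁ ih₂ =>
    have := t.mem_subterms_self
    have := u.mem_subterms_self
    simp only [subterms, Set.mem_union, Set.mem_singleton_iff, par.injEq] at h ⊢
    grind

end PATerm

namespace PAGrammar

variable {T : Type} (G : PAGrammar T)

/-- The terms that occur as parts of configurations which are not yet rewritten. -/
def subterms : Set (PATerm G.NT) :=
  {.var G.initial} ∪ ⋃ r ∈ G.productions, r.2.2.subterms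

theorem finite_subterms : G.subterms.Finite :=
  (Set.finite_singleton _).union
    (G.finite_productions.biUnion fun r _ => r.2.2.finite_subterms)

variable {G}

theorem mem_subterms_iff {t : PATerm G.NT} :
    t ∈ G.subterms ↔ t = .var G.initial ∨ ∃ r ∈ G.productions, t ∈ r.2.2.subterms := by
  simp only [subterms, Set.mem_union, Set.mem_singleton_iff, Set.mem_iUnion, exists_prop]

theorem mem_subterms_of_production {X : G.NT} {x : T} {t : PATerm G.NT}
    (h : (X, x, t) ∈ G.productions) : t ∈ G.subterms :=
  mem_subterms_iff.2 (.inr ⟨_, h, t.mem_subterms_self⟩)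

theorem mem_subterms_of_seq {t u : PATerm G.NT} (h : .seq t u ∈ G.subterms) :
    t ∈ G.subterms ∧ u ∈ G.subterms := by
  obtain h | ⟨r, hr, h⟩ := mem_subterms_iff.1 h
  · cases h
  · exact ⟨mem_subterms_iff.2 (.inr ⟨r, hr, (PATerm.mem_subterms_of_seq h).1⟩),
      mem_subterms_iff.2 (.inr ⟨r, hr, (PATerm.mem_subterms_of_seq h).2⟩)⟩

theorem mem_subterms_of_par {t u : PATerm G.NT} (h : .par t u ∈ G.subterms) :
    t ∈ G.subterms ∧ u ∈ G.subterms := by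
  obtain h | ⟨r, hr, h⟩ := mem_subterms_iff.1 h
  · cases h
  · exact ⟨mem_subterms_iff.2 (.inr ⟨r, hr, (PATerm.mem_subterms_of_par h).1⟩),
      mem_subterms_iff.2 (.inr ⟨r, hr, (PATerm.mem_subterms_of_par h).2⟩)⟩

end PAGrammar

/-! ### `L₃` is not generated by a PA grammar -/

/-- A letter of `w` would occur behind s in one word and before s in the other, hence be b or c and
also a. -/
theorem eq_nil_of_s_mem {p q v w : List Letter} (hs : Letter.s ∈ v)
    (h₁ : p ++ (v ++ w) ++ q ∈ L₃) (h₂ : p ++ (w ++ v) ++ q ∈ L₃) : w = [] := by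
  obtain ⟨x, y, rfl⟩ := append_of_mem hs
  refine eq_nil_iff_forall_not_mem.2 fun l hl => ?_
  have h₃ := (mem_of_append_cons_s_mem_L₃ (x := p ++ x) (y := y ++ w ++ q)
    (by simpa using h₁)).2 l (by simp [hl])
  have h₄ := (mem_of_append_cons_s_mem_L₃ (x := p ++ w ++ x) (y := y ++ q)
    (by simpa using h₂)).1 l (by simp [hl])
  simp [h₄] at h₃

/-- Induction up the derivation tree along the nodes containing s. A child has at most 2D letters a,
and its parent at most max(D, 1) more. This stays below n - D, so the gap of `count_a_of_factor`
brings the parent back to 2D. -/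
theorem count_a_le_of_gen {G : PAGrammar Letter} {D n : ℕ} (hn : 5 * D + 1 < n)
    (hD : ∀ t ∈ G.subterms, ∀ p q, (∀ w, G.Gen t w → Balanced (p ++ w ++ q)) →
      ∀ w, G.Gen t w → NearlyBalanced D w)
    {t : PATerm G.NT} {w : List Letter} (h : G.Gen t w) (ht : t ∈ G.subterms)
    {p q : List Letter} (hpq : ∀ w, G.Gen t w → p ++ w ++ q ∈ L₃)
    (hw : p ++ w ++ q = replicate n .a ++ .s :: (replicate n .b ++ replicate n .c))
    (hs : Letter.s ∈ w) : w.count .a ≤ 2 * D := by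
  have gap := count_a_of_factor hw hs
    (hD t ht p q (fun w hw => balanced_of_mem_L₃ (hpq w hw)) w h)
  induction h generalizing p q with
  | empty => simp at hs
  | @var X x t w hr h ih =>
    rcases mem_cons.1 hs with rfl | hs'
    · have h₁ := (mem_of_append_cons_s_mem_L₃ (x := p) (y := w ++ q)
        (by simpa using hpq _ (.var hr h))).2
      rw [count_cons_of_ne (by simp), count_eq_zero.2 fun hl => by
        simpa using h₁ _ (mem_append_left q hl)]
      exact Nat.zero_le _
    · have ht' := PAGrammar.mem_subterms_of_production hr
      have hpq' : ∀ w, G.Gen t w → (p ++ [x]) ++ w ++ q ∈ L₃ := fun w hw => by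
        simpa using hpq _ (.var hr hw)
      have hw' : (p ++ [x]) ++ w ++ q =
          replicate n .a ++ .s :: (replicate n .b ++ replicate n .c) := by simpa using hw
      have := ih ht' hpq' hw' hs' (count_a_of_factor hw' hs'
        (hD t ht' _ q (fun w hw => balanced_of_mem_L₃ (hpq' w hw)) w h))
      rw [count_cons] at gap ⊢
      split_ifs at gap ⊢ <;> omega
  | @seq t u v w h₁ h₂ ih₁ ih₂ =>
    obtain ⟨ht', hu'⟩ := PAGrammar.mem_subterms_of_seq ht
    have hp : ∀ v, G.Gen t v → p ++ v ++ (w ++ q) ∈ L₃ := fun v hv => by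
      simpa using hpq _ (.seq hv h₂)
    have hq : ∀ w, G.Gen u w → (p ++ v) ++ w ++ q ∈ L₃ := fun w hw => by
      simpa using hpq _ (.seq h₁ hw)
    have hbp := hD t ht' _ _ (fun w hw => balanced_of_mem_L₃ (hp w hw)) v h₁
    have hbq := hD u hu' _ _ (fun w hw => balanced_of_mem_L₃ (hq w hw)) w h₂
    rw [count_append] at gap ⊢
    rcases mem_append.1 hs with hs | hs
    · have hw' : p ++ v ++ (w ++ q) =
          replicate n .a ++ .s :: (replicate n .b ++ replicate n .c) := by simpa using hw
      have := ih₁ ht' hp hw' hs (count_a_of_factor hw' hs hbp)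
      obtain ⟨x, y, rfl⟩ := append_of_mem hs
      have h₃ := (mem_of_append_cons_s_mem_L₃ (x := p ++ x) (y := y ++ w ++ q)
        (by simpa using hp _ h₁)).2
      -- The second factor lies behind s and contributes no a.
      have : w.count .a = 0 := count_eq_zero.2 fun hl => by
        simpa using h₃ _ (mem_append_left q (mem_append_right y hl))
      omega
    · have hw' : (p ++ v) ++ w ++ q =
          replicate n .a ++ .s :: (replicate n .b ++ replicate n .c) := by simpa using hw
      have := ih₂ hu' hq hw' hs (count_a_of_factor hw' hs hbq)
      obtain ⟨x, y, rfl⟩ := append_of_mem hs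
      have h₃ := (mem_of_append_cons_s_mem_L₃ (x := p ++ v ++ x) (y := y ++ q)
        (by simpa using hq _ h₂)).1
      -- The first factor lies before s and has no b, so near-balance allows it at most D letters a.
      have : v.count .b = 0 := count_eq_zero.2 fun hl => by
        simpa using h₃ _ (mem_append_left x (mem_append_right p hl))
      have := hbp.1.1
      omega
  | @par t u v w x h₁ h₂ h ih₁ ih₂ =>
    obtain ⟨ht', hu'⟩ := PAGrammar.mem_subterms_of_par ht
    -- Both concatenations are interleavings, so the component without s is empty and the word
    -- passes unchanged to the other one.
    have h₃ := hpq _ (.par h₁ h₂ (.append v w))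
    have h₄ := hpq _ (.par h₁ h₂ (Interleaving.append w v).symm)
    rcases mem_append.1 (h.perm.mem_iff.1 hs) with hs' | hs'
    · cases eq_nil_of_s_mem hs' h₃ h₄
      cases h.eq_of_nil_right
      exact ih₁ ht' (fun v hv => hpq v (.par hv h₂ (.nil_right v))) hw hs gap
    · cases eq_nil_of_s_mem hs' h₄ h₃
      cases h.eq_of_nil_left
      exact ih₂ hu' (fun v hv => hpq v (.par h₁ hv (.nil_left v))) hw hs gap

theorem L₃_notMem_shuffleCFL : L₃ ∉ ShuffleCFL Letter := by
  rintro ⟨G, hG⟩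
  have hL : ∀ w, w ∈ L₃ ↔ G.Gen (.var G.initial) w := fun w => by
    rw [← hG, PAGrammar.mem_language_iff]
  obtain ⟨D, hD⟩ := exists_nearlyBalanced G.finite_subterms G.Gen
  have hw : replicate (5 * D + 2) .a ++
      .s :: (replicate (5 * D + 2) .b ++ replicate (5 * D + 2) .c) ∈ L₃ :=
    ⟨_, _, .append _ _, rfl⟩
  have := count_a_le_of_gen (n := 5 * D + 2) (p := []) (q := []) (by omega) hD ((hL _).1 hw)
    (.inl rfl) (fun w hw => by simpa using (hL w).2 hw) (by simp) (by simp)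
  simp [count_append, count_replicate] at this
  omega

/-! ### Firing a non-terminal that is independent of everything before it -/

theorem Derives.trans {T C : Type} {step : C → List T → C → Prop} {c d e : C} {u v : List T}
    (h₁ : Derives step c u d) (h₂ : Derives step d v e) : Derives step c (u ++ v) e := by
  induction h₁ with
  | nil c => exact h₂
  | cons h _ ih => rw [append_assoc]; exact .cons h (ih h₂)

namespace PCGrammar

variable {T : Type} {G : PCGrammar T}

theorem derives_move_to_front {X : G.NT} {α : List G.NT} (β : List G.NT)
    (h : ∀ Y ∈ α, G.Indep Y X) : Derives G.Step (α ++ X :: β) [] (X :: (α ++ β)) := by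
  induction α using List.reverseRecOn generalizing β with
  | nil => exact .nil _
  | append_singleton α Y ih =>
    have h₁ := Step.swap α β (h Y (by simp))
    have h₂ := ih (Y :: β) fun Z hZ => h Z (mem_append_left _ hZ)
    simpa using Derives.cons h₁ h₂

theorem derives_cons_of_independent {X : G.NT} {x : T} {α β γ δ : List G.NT} {w : List T}
    (hX : (X, x, γ) ∈ G.productions) (h : ∀ Y ∈ α, G.Indep Y X)
    (hw : Derives G.Step (γ ++ (α ++ β)) w δ) :
    Derives G.Step (α ++ X :: β) (x :: w) δ :=
  (derives_move_to_front β h).trans (.cons (.production _ hX) hw)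

end PCGrammar

/-! ### Shuffles of abc and their partially-commutative grammar -/

/-- The words that complete `i` copies of `abc`, `j` copies of `bc` and `k` copies of `c`,
interleaved with further copies of `abc` unless `i = 0`. -/
inductive Completes : ℕ → ℕ → ℕ → List Letter → Prop
  | nil : Completes 0 0 0 []
  | fork {i j k : ℕ} {w : List Letter} :
      Completes (i + 1) (j + 1) k w → Completes (i + 1) j k (.a :: w)
  | a {i j k : ℕ} {w : List Letter} : Completes i (j + 1) k w → Completes (i + 1) j k (.a :: w)
  | b {i j k : ℕ} {w : List Letter} : Completes i j (k + 1) w → Completes i (j + 1) k (.b :: w)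
  | c {i j k : ℕ} {w : List Letter} : Completes i j k w → Completes i j (k + 1) (.c :: w)

/-- The nonempty interleavings of copies of the word `abc`. -/
def shuffledABC : Language Letter := {w | Completes 1 0 0 w}

namespace Completes

theorem counts {i j k : ℕ} {w : List Letter} (h : Completes i j k w) :
    w.count .b = w.count .a + j ∧ w.count .c = w.count .b + k := by
  induction h with
  | nil => simp
  | fork _ ih | a _ ih | b _ ih | c _ ih => simp; omega

theorem append_c (k : ℕ) : Completes 0 0 k (replicate k .c) := by
  induction k with
  | zero => exact .nil
  | succ k ih => exact .c ih

theorem append_bc (j k : ℕ) :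
    Completes 0 j k (replicate j .b ++ replicate (j + k) .c) := by
  induction j generalizing k with
  | zero => simpa using append_c k
  | succ j ih =>
    rw [Nat.add_right_comm]
    exact .b (ih (k + 1))

theorem append_abc (n j : ℕ) : Completes 1 j 0
    (replicate (n + 1) .a ++ (replicate (n + 1 + j) .b ++ replicate (n + 1 + j) .c)) := by
  induction n generalizing j with
  | zero =>
    rw [Nat.zero_add, Nat.add_comm]
    exact .a (append_bc (j + 1) 0)
  | succ n ih =>
    have := ih (j + 1)
    rw [← Nat.add_assoc, Nat.add_right_comm (n + 1) j 1] at this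
    exact .fork this

/-- Obligations add up under parallel composition, since each letter discharges one obligation of
the side it comes from. This is the parallel case of `shuffledABCPA_completes`. -/
theorem interleaving {i j k i' j' k' : ℕ} {u v w : List Letter} (hu : Completes i j k u)
    (hv : Completes i' j' k' v) (h : Interleaving u v w) :
    Completes (i + i') (j + j') (k + k') w := by
  induction h generalizing i j k i' j' k' with
  | nil => cases hu; cases hv; exact .nil
  | left x _ ih =>
    cases hu with
    | fork hu =>
      have := ih hu hv
      rw [Nat.add_right_comm _ 1, Nat.add_right_comm _ 1] at this
      rw [Nat.add_right_comm _ 1]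
      exact .fork this
    | a hu =>
      have := ih hu hv
      rw [Nat.add_right_comm _ 1] at this
      rw [Nat.add_right_comm _ 1]
      exact .a this
    | b hu =>
      have := ih hu hv
      rw [Nat.add_right_comm _ 1] at this
      rw [Nat.add_right_comm _ 1]
      exact .b this
    | c hu =>
      rw [Nat.add_right_comm _ 1]
      exact .c (ih hu hv)
  | right x _ ih =>
    cases hv with
    | fork hv => exact (ih hu hv).fork
    | a hv => exact (ih hu hv).a
    | b hv => exact (ih hu hv).b
    | c hv => exact (ih hu hv).c

end Completes

theorem balanced_of_mem_shuffledABC {w : List Letter} (h : w ∈ shuffledABC) : Balanced w := by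
  have := Completes.counts h
  exact ⟨this.1.symm, this.2.symm⟩

theorem mem_shuffledABC (n : ℕ) :
    replicate (n + 1) Letter.a ++ (replicate (n + 1) .b ++ replicate (n + 1) .c) ∈ shuffledABC :=
  Completes.append_abc n 0

theorem bac_notMem_shuffledABC : [Letter.b, .a, .c] ∉ shuffledABC := by
  rintro ⟨⟩

theorem acb_notMem_shuffledABC : [Letter.a, .c, .b] ∉ shuffledABC := by
  rintro (_ | ⟨⟨⟩⟩ | ⟨⟨⟩⟩)

/-- A grammar with `a → a·ab | a·b`, `b → b·c` and `c → c`, where different non-terminals are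
independent. -/
abbrev shuffledABCPC : PCGrammar Letter where
  NT := Letter
  finite_NT := inferInstance
  initial := .a
  productions := {(.a, .a, [.a, .b]), (.a, .a, [.b]), (.b, .b, [.c]), (.c, .c, [])}
  finite_productions := Set.toFinite _
  Indep X Y := X ≠ Y
  indep_symm _ _ := Ne.symm
  indep_irrefl _ h := h rfl

/-- The numbers of pending non-terminals are the obligations of `Completes`. Swaps do not change
them, and the four productions are its four rules. -/
theorem shuffledABCPC_completes {α β : List shuffledABCPC.NT} {w : List Letter}
    (h : Derives shuffledABCPC.Step α w β) (hβ : β = []) :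
    Completes (α.count .a) (α.count .b) (α.count .c) w := by
  induction h with
  | nil c => subst hβ; exact .nil
  | cons h _ ih =>
    have ih := ih hβ
    cases h with
    | production β h =>
      rcases h with h | h | h | h <;> cases h
      · simpa [count_cons] using Completes.fork (by simpa [count_cons] using ih)
      · simpa [count_cons] using Completes.a (by simpa [count_cons] using ih)
      · simpa [count_cons] using Completes.b (by simpa [count_cons] using ih)
      · simpa [count_cons] using Completes.c (by simpa [count_cons] using ih)
    | @swap X Y α β h =>
      have hp : (α ++ X :: Y :: β).Perm (α ++ Y :: X :: β) := (Perm.swap _ _ _).append_left α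
      rwa [hp.count_eq, hp.count_eq, hp.count_eq]

theorem shuffledABCPC_derives {i j k : ℕ} {w : List Letter} (h : Completes i j k w)
    {α : List shuffledABCPC.NT} (hi : α.count .a = i) (hj : α.count .b = j) (hk : α.count .c = k)
    (hs : Letter.s ∉ α) : Derives shuffledABCPC.Step α w [] := by
  -- Taking the first occurrence makes everything before it different, hence independent, so it can
  -- be moved to the front.
  have split {x : Letter} {α : List Letter} (h : 0 < α.count x) :
      ∃ β γ, α = β ++ x :: γ ∧ ∀ y ∈ β, y ≠ x := by
    obtain ⟨β, γ, rfl, hx⟩ := eq_append_cons_of_mem (count_pos_iff.1 h)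
    exact ⟨β, γ, rfl, fun y hy e => hx (e ▸ hy)⟩
  induction h generalizing α with
  | nil =>
    cases α with
    | nil => exact .nil _
    | cons x α => cases x <;> simp at hi hj hk hs
  | fork _ ih =>
    obtain ⟨β, γ, rfl, h⟩ := split (x := .a) (α := α) (hi ▸ Nat.succ_pos _)
    refine PCGrammar.derives_cons_of_independent (.inl rfl) h (ih ?_ ?_ ?_ ?_) <;>
      simp at * <;> grind
  | a _ ih =>
    obtain ⟨β, γ, rfl, h⟩ := split (x := .a) (α := α) (hi ▸ Nat.succ_pos _)
    refine PCGrammar.derives_cons_of_independent (.inr (.inl rfl)) h (ih ?_ ?_ ?_ ?_) <;>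
      simp at * <;> grind
  | b _ ih =>
    obtain ⟨β, γ, rfl, h⟩ := split (x := .b) (α := α) (hj ▸ Nat.succ_pos _)
    refine PCGrammar.derives_cons_of_independent (.inr (.inr (.inl rfl))) h (ih ?_ ?_ ?_ ?_) <;>
      simp at * <;> grind
  | c _ ih =>
    obtain ⟨β, γ, rfl, h⟩ := split (x := .c) (α := α) (hk ▸ Nat.succ_pos _)
    refine PCGrammar.derives_cons_of_independent (.inr (.inr (.inr rfl))) h (ih ?_ ?_ ?_ ?_) <;>
      simp at * <;> grind

theorem shuffledABC_mem_trPCCFL : shuffledABC ∈ TrPCCFL Letter := by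
  refine ⟨shuffledABCPC, fun X Y Z h₁ h₂ => ?_, Set.ext fun w => ⟨fun h => ?_, fun h => ?_⟩⟩
  · exact not_not.2 ((not_not.1 h₁).trans (not_not.1 h₂))
  · exact shuffledABCPC_completes h rfl
  · exact shuffledABCPC_derives (α := [.a]) h rfl rfl rfl (by simp)

/-! ### A PA grammar for the shuffles of abc -/

/-- A grammar with `a → a·(a ‖ b) | a·b`, `b → b·c` and `c → c`. -/
abbrev shuffledABCPA : PAGrammar Letter where
  NT := Letter
  finite_NT := inferInstance
  initial := .a
  productions := {(.a, .a, .par (.var .a) (.var .b)), (.a, .a, .var .b), (.b, .b, .var .c),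
    (.c, .c, .empty)}
  finite_productions := Set.toFinite _

/-- The number of occurrences of a non-terminal in a term. -/
def PATerm.count {V : Type} [DecidableEq V] (X : V) : PATerm V → ℕ
  | .empty => 0
  | .var Y => if Y = X then 1 else 0
  | .seq t u => t.count X + u.count X
  | .par t u => t.count X + u.count X

/-- Terms that do not contain sequential compositions. -/
def PATerm.IsParallel {V : Type} : PATerm V → Prop
  | .empty => True
  | .var _ => True
  | .seq _ _ => False
  | .par t u => t.IsParallel ∧ u.IsParallel

theorem shuffledABCPA_completes {t : PATerm shuffledABCPA.NT} {w : List Letter}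
    (h : shuffledABCPA.Gen t w) (ht : t.IsParallel) :
    Completes (t.count .a) (t.count .b) (t.count .c) w := by
  induction h with
  | empty => exact .nil
  | var h _ ih =>
    rcases h with h | h | h | h <;> cases h
    · exact .fork (ih ⟨trivial, trivial⟩)
    · exact .a (ih trivial)
    · exact .b (ih trivial)
    · exact .c (ih trivial)
  | seq _ _ _ _ => exact ht.elim
  | par _ _ h ih₁ ih₂ => exact (ih₁ ht.1).interleaving (ih₂ ht.2) h

/-- Without sequential compositions nothing blocks an occurrence of a non-terminal, so a term
behaves like a multiset. The fired occurrence is added on the left to avoid truncated subtraction.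
-/
theorem shuffledABCPA_exists_step {X : shuffledABCPA.NT} {x : Letter} {u : PATerm shuffledABCPA.NT}
    (hX : (X, x, u) ∈ shuffledABCPA.productions) (hu : u.IsParallel) {t : PATerm shuffledABCPA.NT}
    (ht : t.IsParallel) (h : 0 < t.count X) :
    ∃ t', shuffledABCPA.Step t x t' ∧ t'.IsParallel ∧
      ∀ Y, t'.count Y + (if X = Y then 1 else 0) = t.count Y + u.count Y := by
  induction t with
  | empty => simp [PATerm.count] at h
  | var Y =>
    obtain rfl : Y = X := by by_contra hY; simp [PATerm.count, hY] at h
    exact ⟨u, .production hX, hu, fun Z => by rw [PATerm.count, Nat.add_comm]⟩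
  | seq t₁ t₂ => exact ht.elim
  | par t₁ t₂ ih₁ ih₂ =>
    by_cases h₁ : 0 < t₁.count X
    · obtain ⟨t', h₂, h₃, h₄⟩ := ih₁ ht.1 h₁
      refine ⟨_, .par_left t₂ h₂, ⟨h₃, ht.2⟩, fun Y => ?_⟩
      have := h₄ Y
      simp only [PATerm.count]
      omega
    · obtain ⟨t', h₂, h₃, h₄⟩ := ih₂ ht.2 (by simp only [PATerm.count] at h; omega)
      refine ⟨_, .par_right t₁ h₂, ⟨ht.1, h₃⟩, fun Y => ?_⟩
      have := h₄ Y
      simp only [PATerm.count]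
      omega

theorem shuffledABCPA_gen_nil {t : PATerm shuffledABCPA.NT} (ht : t.IsParallel)
    (h : ∀ X, t.count X = 0) : shuffledABCPA.Gen t [] := by
  induction t with
  | empty => exact .empty
  | var X => simpa [PATerm.count] using h X
  | seq t₁ t₂ => exact ht.elim
  | par t₁ t₂ ih₁ ih₂ =>
    simp only [PATerm.count, Nat.add_eq_zero_iff] at h
    exact .par (ih₁ ht.1 fun X => (h X).1) (ih₂ ht.2 fun X => (h X).2) .nil

theorem shuffledABCPA_gen {i j k : ℕ} {w : List Letter} (h : Completes i j k w)
    {t : PATerm shuffledABCPA.NT} (ht : t.IsParallel) (hi : t.count .a = i) (hj : t.count .b = j)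
    (hk : t.count .c = k) (hs : t.count .s = 0) : shuffledABCPA.Gen t w := by
  induction h generalizing t with
  | nil =>
    exact shuffledABCPA_gen_nil ht fun X => by cases X <;> assumption
  | fork _ ih =>
    obtain ⟨t', h₁, h₂, h₃⟩ := shuffledABCPA_exists_step (X := .a) (.inl rfl)
      ⟨trivial, trivial⟩ ht (by omega)
    refine h₁.gen_cons (ih h₂ ?_ ?_ ?_ ?_)
    · have := h₃ .a; simp [PATerm.count] at this; omega
    · have := h₃ .b; simp [PATerm.count] at this; omega
    · have := h₃ .c; simp [PATerm.count] at this; omega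
    · have := h₃ .s; simp [PATerm.count] at this; omega
  | a _ ih =>
    obtain ⟨t', h₁, h₂, h₃⟩ := shuffledABCPA_exists_step (X := .a) (.inr (.inl rfl))
      trivial ht (by omega)
    refine h₁.gen_cons (ih h₂ ?_ ?_ ?_ ?_)
    · have := h₃ .a; simp [PATerm.count] at this; omega
    · have := h₃ .b; simp [PATerm.count] at this; omega
    · have := h₃ .c; simp [PATerm.count] at this; omega
    · have := h₃ .s; simp [PATerm.count] at this; omega
  | b _ ih =>
    obtain ⟨t', h₁, h₂, h₃⟩ := shuffledABCPA_exists_step (X := .b) (.inr (.inr (.inl rfl)))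
      trivial ht (by omega)
    refine h₁.gen_cons (ih h₂ ?_ ?_ ?_ ?_)
    · have := h₃ .a; simp [PATerm.count] at this; omega
    · have := h₃ .b; simp [PATerm.count] at this; omega
    · have := h₃ .c; simp [PATerm.count] at this; omega
    · have := h₃ .s; simp [PATerm.count] at this; omega
  | c _ ih =>
    obtain ⟨t', h₁, h₂, h₃⟩ := shuffledABCPA_exists_step (X := .c) (.inr (.inr (.inr rfl)))
      trivial ht (by omega)
    refine h₁.gen_cons (ih h₂ ?_ ?_ ?_ ?_)
    · have := h₃ .a; simp [PATerm.count] at this; omega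
    · have := h₃ .b; simp [PATerm.count] at this; omega
    · have := h₃ .c; simp [PATerm.count] at this; omega
    · have := h₃ .s; simp [PATerm.count] at this; omega

theorem shuffledABC_mem_shuffleCFL : shuffledABC ∈ ShuffleCFL Letter :=
  ⟨shuffledABCPA, Set.ext fun _ => PAGrammar.mem_language_iff.trans
    ⟨fun h => shuffledABCPA_completes h trivial,
      fun h => shuffledABCPA_gen h (t := .var .a) trivial rfl rfl rfl rfl⟩⟩

end PartialComm

/-! ### Compositional semantics of context-free grammars -/

namespace ContextFreeGrammar

variable {T : Type*} (g : ContextFreeGrammar T)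

/-- The words derivable from a string of symbols, described by recursion on the string. -/
inductive Gen : List (Symbol T g.NT) → List T → Prop
  | nil : Gen [] []
  | terminal (x : T) {α : List (Symbol T g.NT)} {w : List T} :
      Gen α w → Gen (.terminal x :: α) (x :: w)
  | nonterminal {r : ContextFreeRule T g.NT} {α : List (Symbol T g.NT)} {v w : List T} :
      r ∈ g.rules → Gen r.output v → Gen α w → Gen (.nonterminal r.input :: α) (v ++ w)

variable {g}

theorem Gen.exists_of_append {α β : List (Symbol T g.NT)} {x : List T} (h : g.Gen (α ++ β) x) :
    ∃ v w, g.Gen α v ∧ g.Gen β w ∧ x = v ++ w := by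
  generalize hγ : α ++ β = γ at h
  induction h generalizing α with
  | nil =>
    obtain ⟨rfl, rfl⟩ := append_eq_nil_iff.1 hγ
    exact ⟨[], [], .nil, .nil, rfl⟩
  | terminal x h ih =>
    cases α with
    | nil => cases hγ; exact ⟨[], _, .nil, .terminal x h, rfl⟩
    | cons y α =>
      obtain ⟨rfl, hγ'⟩ := cons_eq_cons.1 hγ
      obtain ⟨v, w, h₁, h₂, rfl⟩ := ih hγ'
      exact ⟨x :: v, w, .terminal x h₁, h₂, rfl⟩
  | nonterminal hr hv h _ ih =>
    cases α with
    | nil => cases hγ; exact ⟨[], _, .nil, .nonterminal hr hv h, rfl⟩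
    | cons y α =>
      obtain ⟨rfl, hγ'⟩ := cons_eq_cons.1 hγ
      obtain ⟨v, w, h₁, h₂, rfl⟩ := ih hγ'
      exact ⟨_, w, .nonterminal hr hv h₁, h₂, (append_assoc ..).symm⟩

theorem Gen.append {α β : List (Symbol T g.NT)} {v w : List T} (hv : g.Gen α v)
    (hw : g.Gen β w) : g.Gen (α ++ β) (v ++ w) := by
  induction hv with
  | nil => exact hw
  | terminal x _ ih => exact .terminal x ih
  | nonterminal hr h _ _ ih => rw [append_assoc]; exact .nonterminal hr h ih

theorem Gen.eq_nil {w : List T} (h : g.Gen [] w) : w = [] := by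
  cases h
  rfl

theorem Gen.exists_of_terminal {x : T} {α : List (Symbol T g.NT)} {w : List T}
    (h : g.Gen (.terminal x :: α) w) : ∃ v, g.Gen α v ∧ w = x :: v := by
  cases h with
  | terminal _ h => exact ⟨_, h, rfl⟩

theorem Gen.exists_of_nonterminal {X : g.NT} {α : List (Symbol T g.NT)} {x : List T}
    (h : g.Gen (.nonterminal X :: α) x) :
    ∃ r v w, r ∈ g.rules ∧ r.input = X ∧ g.Gen r.output v ∧ g.Gen α w ∧ x = v ++ w := by
  cases h with
  | nonterminal hr hv hw => exact ⟨_, _, _, hr, rfl, hv, hw, rfl⟩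

theorem gen_map_terminal (w : List T) : g.Gen (w.map .terminal) w := by
  induction w with
  | nil => exact .nil
  | cons x w ih => exact .terminal x ih

theorem Gen.of_produces {α β : List (Symbol T g.NT)} (h : g.Produces α β) {w : List T}
    (hw : g.Gen β w) : g.Gen α w := by
  obtain ⟨r, hr, h⟩ := h
  induction h generalizing w with
  | head α =>
    obtain ⟨v, w, h₁, h₂, rfl⟩ := hw.exists_of_append
    exact .nonterminal hr h₁ h₂
  | cons x _ ih =>
    cases hw with
    | terminal x hw => exact .terminal x (ih hw)
    | nonterminal hr' hv hw => exact .nonterminal hr' hv (ih hw)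

theorem Gen.derives {α : List (Symbol T g.NT)} {w : List T} (h : g.Gen α w) :
    g.Derives α (w.map .terminal) := by
  induction h with
  | nil => rfl
  | terminal x _ ih => exact ih.append_left [.terminal x]
  | @nonterminal r α v w hr _ _ ih₁ ih₂ =>
    rw [map_append]
    exact (Produces.trans_derives ⟨r, hr, .head α⟩ (ih₁.append_right α)).trans
      (ih₂.append_left _)

theorem mem_language_iff_gen {w : List T} :
    w ∈ g.language ↔ g.Gen [.nonterminal g.initial] w := by
  refine ⟨fun h => ?_, Gen.derives⟩
  rw [mem_language_iff] at h
  generalize [Symbol.nonterminal g.initial] = α at h ⊢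
  induction h using Relation.ReflTransGen.head_induction_on with
  | refl => exact gen_map_terminal w
  | head h _ ih => exact .of_produces h ih

/-- The strings that occur as final parts of right-hand sides, and the initial string. -/
def suffixes (g : ContextFreeGrammar T) : Set (List (Symbol T g.NT)) :=
  {α | α <:+ [.nonterminal g.initial] ∨ ∃ r ∈ g.rules, α <:+ r.output}

theorem finite_suffixes (g : ContextFreeGrammar T) : g.suffixes.Finite := by
  have key (β : List (Symbol T g.NT)) : {α | α <:+ β}.Finite := by
    simpa only [← mem_tails] using β.tails.finite_toSet
  have : g.suffixes = {α | α <:+ [.nonterminal g.initial]} ∪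
      ⋃ r ∈ (g.rules : Set (ContextFreeRule T g.NT)), {α | α <:+ r.output} := by
    ext α
    simp [suffixes]
  rw [this]
  exact (key _).union (g.rules.finite_toSet.biUnion fun r _ => key r.output)

theorem mem_suffixes_of_cons {x : Symbol T g.NT} {α : List (Symbol T g.NT)}
    (h : x :: α ∈ g.suffixes) : α ∈ g.suffixes :=
  h.imp (suffix_cons x α).trans fun ⟨r, hr, h⟩ => ⟨r, hr, (suffix_cons x α).trans h⟩

end ContextFreeGrammar

/-! ### `shuffledABC` is not the trace closure of a context-free language -/

namespace PartialComm

open ContextFreeGrammar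

theorem length_eq_of_s_notMem {w : List Letter} (h : Letter.s ∉ w) :
    w.length = w.count .a + w.count .b + w.count .c := by
  induction w with
  | nil => rfl
  | cons x w ih =>
    have := ih fun hs => h (mem_cons_of_mem x hs)
    cases x <;> simp at h ⊢ <;> omega

/-- A nearly balanced factor of `aⁿ bⁿ cⁿ` which is shorter than `n` is very short. -/
theorem length_le_of_factor {n D : ℕ} {p q w : List Letter}
    (h : p ++ w ++ q = replicate n .a ++ (replicate n .b ++ replicate n .c))
    (hn : w.length < n) (hw : NearlyBalanced D w) : w.length ≤ 3 * D := by
  have hs : Letter.s ∉ w := fun hs => by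
    have : Letter.s ∈ p ++ w ++ q := by simp [hs]
    rw [h] at this
    simp [mem_replicate] at this
  rw [length_eq_of_s_notMem hs] at hn ⊢
  -- A factor meeting both a and c contains the whole block of n letters b, which is too long.
  have : w.count .a = 0 ∨ w.count .c = 0 := by
    rw [append_assoc] at h
    rcases append_eq_append_iff.1 h with ⟨r, h₁, h₂⟩ | ⟨r, _, h₂⟩
    · right
      rcases append_eq_append_iff.1 h₂ with ⟨t, rfl, _⟩ | ⟨t, rfl, h₃⟩
      · refine count_eq_zero.2 fun hl => ?_
        have := h₁ ▸ mem_append_right p (mem_append_left t hl)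
        cases eq_of_mem_replicate this
      · rcases append_eq_append_iff.1 h₃.symm with ⟨u, h₄, _⟩ | ⟨u, rfl, _⟩
        · refine count_eq_zero.2 fun hl => ?_
          rcases mem_append.1 hl with hl | hl
          · cases eq_of_mem_replicate (h₁ ▸ mem_append_right p hl)
          · cases eq_of_mem_replicate (h₄ ▸ mem_append_left u hl)
        · simp at hn
          omega
    · left
      refine count_eq_zero.2 fun hl => ?_
      have : Letter.a ∈ replicate n Letter.b ++ replicate n .c :=
        h₂ ▸ mem_append_right r (mem_append_left q hl)
      simp [mem_replicate] at this
  unfold NearlyBalanced at hw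
  omega

/-- `Gen` peels strings from the left, so the strings met are suffixes of right-hand sides. Two
factors of length at most 3D join to length at most 6D < n, and `length_le_of_factor` brings this
back to 3D. -/
theorem length_le_of_gen {g : ContextFreeGrammar Letter} {D n : ℕ} (hn : 6 * D + 1 < n)
    (hD : ∀ α ∈ g.suffixes, ∀ p q, (∀ w, g.Gen α w → Balanced (p ++ w ++ q)) →
      ∀ w, g.Gen α w → NearlyBalanced D w)
    {α : List (Symbol Letter g.NT)} {w : List Letter} (h : g.Gen α w) (hα : α ∈ g.suffixes)
    {p q : List Letter} (hpq : ∀ w, g.Gen α w → Balanced (p ++ w ++ q))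
    (hw : p ++ w ++ q = replicate n .a ++ (replicate n .b ++ replicate n .c)) :
    w.length ≤ 3 * D := by
  have hb := hD α hα p q hpq w h
  induction h generalizing p q with
  | nil => exact Nat.zero_le _
  | @terminal x α w h ih =>
    have hα' := mem_suffixes_of_cons hα
    have hpq' : ∀ w, g.Gen α w → Balanced ((p ++ [x]) ++ w ++ q) := fun w hw => by
      simpa using hpq _ (.terminal x hw)
    have := ih hα' hpq' (by simpa using hw) (hD α hα' _ q hpq' w h)
    exact length_le_of_factor hw (by rw [length_cons]; omega) hb
  | @nonterminal r α v w hr h₁ h₂ ih₁ ih₂ =>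
    have hα' := mem_suffixes_of_cons hα
    have hr' : r.output ∈ g.suffixes := .inr ⟨r, hr, suffix_rfl⟩
    have hp : ∀ v, g.Gen r.output v → Balanced (p ++ v ++ (w ++ q)) := fun v hv => by
      simpa using hpq _ (.nonterminal hr hv h₂)
    have hq : ∀ w, g.Gen α w → Balanced ((p ++ v) ++ w ++ q) := fun w hw => by
      simpa using hpq _ (.nonterminal hr h₁ hw)
    have := ih₁ hr' hp (by simpa using hw) (hD _ hr' _ _ hp v h₁)
    have := ih₂ hα' hq (by simpa using hw) (hD _ hα' _ _ hq w h₂)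
    exact length_le_of_factor hw (by rw [length_append]; omega) hb

theorem exists_notMem_of_balanced {K : Language Letter} (hK : K.IsContextFree)
    (hb : ∀ w ∈ K, Balanced w) :
    ∃ n, replicate (n + 1) Letter.a ++ (replicate (n + 1) .b ++ replicate (n + 1) .c) ∉ K := by
  obtain ⟨g, rfl⟩ := hK
  obtain ⟨D, hD⟩ := exists_nearlyBalanced g.finite_suffixes g.Gen
  refine ⟨6 * D + 1, fun h => ?_⟩
  have := length_le_of_gen (n := 6 * D + 2) (p := []) (q := []) (by omega) hD
    (mem_language_iff_gen.1 h) (.inl suffix_rfl)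
    (fun w hw => by simpa using hb w (mem_language_iff_gen.2 hw)) (by simp)
  simp at this
  omega

/-- Two neighbouring letters of `aⁿ bⁿ cⁿ` are equal, or `ab`, or `bc`. -/
theorem neighbours_of_eq {n : ℕ} {u v : List Letter} {x y : Letter}
    (h : u ++ x :: y :: v = replicate n .a ++ (replicate n .b ++ replicate n .c)) (hxy : x ≠ y) :
    n = 0 ∨ x = .a ∧ y = .b ∨ x = .b ∧ y = .c := by
  have : List.IsChain (fun x y : Letter => x = y ∨ n = 0 ∨ x = .a ∧ y = .b ∨ x = .b ∧ y = .c)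
      (replicate n .a ++ (replicate n .b ++ replicate n .c)) := by
    have h (x : Letter) : List.IsChain (fun x y : Letter =>
        x = y ∨ n = 0 ∨ x = .a ∧ y = .b ∨ x = .b ∧ y = .c) (replicate n x) :=
      isChain_replicate_of_rel n (.inl rfl)
    refine isChain_append.2 ⟨h _, isChain_append.2 ⟨h _, h _, ?_⟩, ?_⟩ <;>
      cases n <;> simp [getLast?_replicate, head?_replicate]
  rw [← h] at this
  simpa [hxy] using (isChain_append.1 this).2.1.rel

theorem shuffledABC_notMem_traceCFL : shuffledABC ∉ TraceCFL Letter := by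
  rintro ⟨I, hsymm, hirrefl, K, hK, hL⟩
  have closed {x y : Letter} {u v : List Letter} (h : I x y)
      (hm : u ++ x :: y :: v ∈ shuffledABC) : u ++ y :: x :: v ∈ shuffledABC := by
    rw [← hL] at hm ⊢
    obtain ⟨w, hw, hm⟩ := hm
    exact ⟨w, hw, .head (.swap u v (hsymm _ _ h)) hm⟩
  have hab : ¬ I .a .b := fun h =>
    bac_notMem_shuffledABC (closed (u := []) h (mem_shuffledABC 0))
  have hbc : ¬ I .b .c := fun h =>
    acb_notMem_shuffledABC (closed (u := [.a]) (v := []) h (mem_shuffledABC 0))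
  obtain ⟨n, hn⟩ := exists_notMem_of_balanced hK fun w hw =>
    balanced_of_mem_shuffledABC (hL ▸ (⟨w, hw, .refl⟩ : w ∈ traceClosure I K))
  obtain ⟨w, hw, h⟩ : _ ∈ traceClosure I K := hL ▸ mem_shuffledABC n
  -- With no swap the word lies in `K`. A first swap would exchange unequal neighbours, which are ab
  -- or bc.
  rcases Relation.ReflTransGen.cases_head h with rfl | ⟨_, h, _⟩
  · exact hn hw
  · generalize hv : replicate (n + 1) Letter.a ++ _ = v at h
    cases h with
    | @swap x y u v h =>
      rcases neighbours_of_eq hv.symm fun e => hirrefl y (e ▸ h) with h' | ⟨rfl, rfl⟩ | ⟨rfl, rfl⟩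
      · cases h'
      · exact hab h
      · exact hbc h

/-! ### `L₃` is the trace closure of a context-free language -/

theorem interleaving_of_forall {v : List Letter} (h : ∀ l ∈ v, l = .b ∨ l = .c) :
    Interleaving (replicate (v.count .b) .b) (replicate (v.count .c) .c) v := by
  induction v with
  | nil => exact .nil
  | cons x v ih =>
    have ih := ih fun l hl => h l (mem_cons_of_mem x hl)
    rcases h x mem_cons_self with rfl | rfl
    · simpa [replicate_succ] using ih.left .b
    · simpa [replicate_succ] using ih.right .c

/-- A word over b and c is determined by its counts up to interleaving, so membership becomes a
condition that is visibly stable under permuting the part behind s. -/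
theorem mem_L₃_iff_count {w : List Letter} :
    w ∈ L₃ ↔ ∃ n v, (∀ l ∈ v, l = .b ∨ l = .c) ∧ v.count .b = n ∧ v.count .c = n ∧
      w = replicate n .a ++ .s :: v := by
  constructor
  · rintro ⟨n, v, hv, rfl⟩
    refine ⟨n, v, fun l hl => ?_, ?_, ?_, rfl⟩
    · exact (mem_append.1 (hv.perm.mem_iff.1 hl)).imp eq_of_mem_replicate eq_of_mem_replicate
    · simp [hv.count_eq, count_replicate]
    · simp [hv.count_eq, count_replicate]
  · rintro ⟨n, v, hv, hb, hc, rfl⟩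
    have := interleaving_of_forall hv
    rw [hb, hc] at this
    exact ⟨n, v, this, rfl⟩

/-- The independence of `b` and `c`. -/
def IndepBC (x y : Letter) : Prop := x = .b ∧ y = .c ∨ x = .c ∧ y = .b

theorem mem_L₃_of_letterSwap {v w : List Letter} (h : LetterSwap IndepBC v w) (hw : w ∈ L₃) :
    v ∈ L₃ := by
  cases h with
  | @swap x y u t h =>
    have hx : x = .b ∨ x = .c := by rcases h with ⟨rfl, -⟩ | ⟨rfl, -⟩ <;> simp
    have hy : y = .b ∨ y = .c := by rcases h with ⟨-, rfl⟩ | ⟨-, rfl⟩ <;> simp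
    have hw' := hw
    obtain ⟨n, v, hv, hb, hc, hw⟩ := mem_L₃_iff_count.1 hw
    have key : ∃ r, u = replicate n .a ++ .s :: r := by
      -- The swapped letters are b and c, so they cannot precede s.
      have hs : Letter.s ∈ u := by
        have : Letter.s ∈ u ++ y :: x :: t := by simp [hw]
        simp only [mem_append, mem_cons] at this
        rcases this with h | rfl | rfl | h
        · exact h
        · simp at hy
        · simp at hx
        · obtain ⟨p, r, rfl⟩ := append_of_mem h
          have := (mem_of_append_cons_s_mem_L₃ (x := u ++ y :: x :: p) (y := r)
            (by simpa using hw')).1 y (by simp)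
          simp [this] at hy
      obtain ⟨p, r, rfl⟩ := append_of_mem hs
      have hs' : Letter.s ∉ v := fun h => by simpa using hv _ h
      refine ⟨r, ?_⟩
      rw [(eq_of_append_cons_s_eq (x := p) (y := r ++ y :: x :: t) hs' (by simpa using hw)).1]
    obtain ⟨r, rfl⟩ := key
    obtain rfl : v = r ++ y :: x :: t := by simpa using hw.symm
    have hp : (r ++ x :: y :: t).Perm (r ++ y :: x :: t) := (Perm.swap _ _ _).append_left r
    exact mem_L₃_iff_count.2 ⟨n, r ++ x :: y :: t, fun l hl => hv l (hp.mem_iff.1 hl),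
      by rw [hp.count_eq, hb], by rw [hp.count_eq, hc], by simp⟩

theorem TraceEquiv.append_left {T : Type} {I : T → T → Prop} {v w : List T}
    (h : TraceEquiv I v w) (u : List T) : TraceEquiv I (u ++ v) (u ++ w) := by
  refine Relation.ReflTransGen.lift (u ++ ·) (fun _ _ h => ?_) _ _ h
  cases h with
  | swap p q h => simpa using LetterSwap.swap (u ++ p) q h

theorem TraceEquiv.of_perm {T : Type} {I : T → T → Prop} {v w : List T} (h : v.Perm w)
    (hI : ∀ x ∈ v, ∀ y ∈ v, x ≠ y → I x y) : TraceEquiv I v w := by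
  induction h with
  | nil => exact .refl
  | cons x _ ih =>
    exact (ih fun y hy z hz => hI y (mem_cons_of_mem x hy) z (mem_cons_of_mem x hz)).append_left [x]
  | swap x y l =>
    -- Exchanging equal letters is no step at all, and independence is only assumed for distinct
    -- ones.
    by_cases hxy : y = x
    · subst hxy; exact .refl
    · exact .single (.swap [] l (hI y (by simp) x (by simp) hxy))
  | trans h _ ih₁ ih₂ =>
    exact (ih₁ hI).trans (ih₂ fun x hx y hy => hI x (h.mem_iff.2 hx) y (h.mem_iff.2 hy))

/-- The grammar `S → a S b c | s`. -/
abbrev grammarBC : ContextFreeGrammar Letter where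
  NT := Unit
  initial := ()
  rules := ⟨{⟨(), [.terminal .a, .nonterminal (), .terminal .b, .terminal .c]⟩,
    ⟨(), [.terminal .s]⟩}, by simp⟩

theorem mem_grammarBC_rules {r : ContextFreeRule Letter Unit} : r ∈ grammarBC.rules ↔
    r = ⟨(), [.terminal .a, .nonterminal (), .terminal .b, .terminal .c]⟩ ∨
      r = ⟨(), [.terminal .s]⟩ := by
  change r ∈ ({_, _} : Multiset _) ↔ _
  simp

/-- The context-free core yields aⁿ s (bc)ⁿ. The induction is on length because the inner word only
appears after the right-hand side has been split. -/
theorem mem_L₃_of_grammarBC {w : List Letter} (h : grammarBC.Gen [.nonterminal ()] w) :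
    w ∈ L₃ := by
  induction hn : w.length using Nat.strong_induction_on generalizing w with
  | _ n ih =>
    obtain ⟨r, v, _, hr, -, hv, hnil, rfl⟩ := h.exists_of_nonterminal
    obtain rfl := hnil.eq_nil
    rcases mem_grammarBC_rules.1 hr with rfl | rfl
    · obtain ⟨_, hv₁, rfl⟩ := hv.exists_of_terminal
      obtain ⟨u, _, hu, h₁, rfl⟩ := ContextFreeGrammar.Gen.exists_of_append
        (g := grammarBC) (α := [.nonterminal ()])
        (β := [.terminal Letter.b, .terminal Letter.c]) hv₁
      obtain ⟨_, h₂, rfl⟩ := h₁.exists_of_terminal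
      obtain ⟨_, hnil, rfl⟩ := h₂.exists_of_terminal
      obtain rfl := hnil.eq_nil
      obtain ⟨m, v, hbc, hb, hc, rfl⟩ :=
        mem_L₃_iff_count.1 (ih u.length (by simp at hn; omega) hu rfl)
      refine mem_L₃_iff_count.2 ⟨m + 1, v ++ [.b, .c], ?_, ?_, ?_, ?_⟩
      · intro l hl
        rcases mem_append.1 hl with hl | hl
        · exact hbc l hl
        · simpa using hl
      · simp [hb]
      · simp [hc]
      · simp [replicate_succ]
    · obtain ⟨_, hnil, rfl⟩ := hv.exists_of_terminal
      obtain rfl := hnil.eq_nil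
      exact mem_L₃_iff_count.2 ⟨0, [], by simp, rfl, rfl, rfl⟩

theorem exists_gen_grammarBC (n : ℕ) :
    ∃ v : List Letter, (∀ l ∈ v, l = .b ∨ l = .c) ∧ v.count .b = n ∧ v.count .c = n ∧
      grammarBC.Gen [.nonterminal ()] (replicate n .a ++ .s :: v) := by
  induction n with
  | zero =>
    refine ⟨[], by simp, rfl, rfl, ?_⟩
    exact .nonterminal (v := [.s]) (mem_grammarBC_rules.2 (.inr rfl)) (.terminal _ .nil) .nil
  | succ n ih =>
    obtain ⟨v, h, hb, hc, hv⟩ := ih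
    refine ⟨v ++ [.b, .c], ?_, by simp [hb], by simp [hc], ?_⟩
    · intro l hl
      rcases mem_append.1 hl with hl | hl
      · exact h l hl
      · simpa using hl
    · have h₁ := ContextFreeGrammar.Gen.terminal Letter.a (hv.append
        (ContextFreeGrammar.gen_map_terminal [.b, .c]))
      have h₂ := ContextFreeGrammar.Gen.nonterminal (mem_grammarBC_rules.2 (.inl rfl)) h₁ .nil
      simpa [replicate_succ] using h₂

theorem L₃_mem_traceCFL : L₃ ∈ TraceCFL Letter := by
  refine ⟨IndepBC, fun x y h => ?_, fun x h => ?_, grammarBC.language, ⟨_, rfl⟩,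
    Set.ext fun w => ⟨?_, fun h => ?_⟩⟩
  · exact h.symm.imp And.symm And.symm
  · rcases h with ⟨rfl, h⟩ | ⟨rfl, h⟩ <;> cases h
  · rintro ⟨v, hv, h⟩
    have hv := mem_L₃_of_grammarBC (ContextFreeGrammar.mem_language_iff_gen.1 hv)
    induction h using Relation.ReflTransGen.head_induction_on with
    | refl => exact hv
    | head h _ ih => exact mem_L₃_of_letterSwap h ih
  · obtain ⟨n, v, hv, hb, hc, rfl⟩ := mem_L₃_iff_count.1 h
    obtain ⟨v', hv', hb', hc', h⟩ := exists_gen_grammarBC n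
    refine ⟨_, ContextFreeGrammar.mem_language_iff_gen.2 h, ?_⟩
    refine TraceEquiv.append_left (u := replicate n Letter.a)
      (TraceEquiv.append_left (u := [Letter.s]) ?_)
    refine .of_perm (perm_iff_count.2 fun l => ?_) fun x hx y hy hxy => ?_
    · have key {v : List Letter} (h : ∀ l ∈ v, l = .b ∨ l = .c) :
          v.count .a = 0 ∧ v.count .s = 0 := by
        constructor <;> refine count_eq_zero.2 fun hl => ?_ <;> simpa using h _ hl
      have := key hv
      have := key hv'
      cases l <;> omega
    · rcases hv x hx with rfl | rfl <;> rcases hv y hy with rfl | rfl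
      · exact absurd rfl hxy
      · exact .inl ⟨rfl, rfl⟩
      · exact .inr ⟨rfl, rfl⟩
      · exact absurd rfl hxy

/-! ### A partially-commutative grammar for `L₃` -/

/-- The dependence class of a non-terminal of `L₃PC`. -/
def dependenceClass : Letter → Letter
  | .a => .s
  | x => x

/-- A grammar with `s → a·sa | s`, `a → b·c | c·b`, `b → b` and `c → c`, where `s` and `a` are
dependent. -/
abbrev L₃PC : PCGrammar Letter where
  NT := Letter
  finite_NT := inferInstance
  initial := .s
  productions := {(.s, .a, [.s, .a]), (.s, .s, []), (.a, .b, [.c]), (.a, .c, [.b]), (.b, .b, []),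
    (.c, .c, [])}
  finite_productions := Set.toFinite _
  Indep X Y := dependenceClass X ≠ dependenceClass Y
  indep_symm _ _ := Ne.symm
  indep_irrefl _ h := h rfl

/-- Once s is gone, each pending a yields exactly one b and one c, in either order, and swaps keep
all counts. -/
theorem L₃PC_sound_of_s_notMem {α β : List L₃PC.NT} {w : List Letter}
    (h : Derives L₃PC.Step α w β) (hβ : β = []) (hs : Letter.s ∉ α) :
    (∀ l ∈ w, l = .b ∨ l = .c) ∧ w.count .b = α.count .a + α.count .b ∧
      w.count .c = α.count .a + α.count .c := by
  induction h with
  | nil => subst hβ; simp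
  | cons h _ ih =>
    have ih := ih hβ
    cases h with
    | production β h =>
      rcases h with h | h | h | h | h | h <;> cases h <;> simp at ih hs ⊢ <;>
        have ih := ih hs <;> refine ⟨ih.1, ?_, ?_⟩ <;> omega
    | @swap X Y α β h =>
      have hp : (α ++ X :: Y :: β).Perm (α ++ Y :: X :: β) := (Perm.swap _ _ _).append_left α
      rw [hp.count_eq, hp.count_eq, hp.count_eq]
      exact ih fun h => hs (hp.mem_iff.2 h)

theorem L₃PC_sound {k : ℕ} {α β : List L₃PC.NT} {w : List Letter}
    (h : Derives L₃PC.Step α w β) (hβ : β = []) (hα : α = .s :: replicate k .a) :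
    ∃ m v, (∀ l ∈ v, l = .b ∨ l = .c) ∧ v.count .b = k + m ∧ v.count .c = k + m ∧
      w = replicate m .a ++ .s :: v := by
  induction h generalizing k with
  | nil => subst hβ; cases hα
  | cons h h' ih =>
    cases h with
    | production β h =>
      obtain ⟨rfl, rfl⟩ := cons_eq_cons.1 hα
      rcases h with h | h | h | h | h | h <;> cases h
      · obtain ⟨m, v, hv, hb, hc, rfl⟩ := ih (k := k + 1) hβ (by simp [replicate_succ])
        exact ⟨m + 1, v, hv, by omega, by omega, by simp [replicate_succ]⟩
      · have := L₃PC_sound_of_s_notMem h' hβ (by simp [mem_replicate])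
        exact ⟨0, _, this.1, by simp [this.2, count_replicate], by simp [this.2, count_replicate],
          rfl⟩
    | @swap X Y α β h =>
      -- While s is present the configuration lies in a single dependence class, so it acts as a
      -- stack: no swap is possible and s stays in front.
      have key (Z : Letter) (hZ : Z ∈ α ++ X :: Y :: β) : dependenceClass Z = .s := by
        rw [hα] at hZ
        rcases mem_cons.1 hZ with rfl | hZ
        · rfl
        · rw [eq_of_mem_replicate hZ]; rfl
      exact absurd ((key X (by simp)).trans (key Y (by simp)).symm) h

/-- Greedy reading: a letter is read from a pending non-terminal of the same name if there is one,
and otherwise from an a, which then leaves the other letter pending. The counts ensure that such an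
a exists. -/
theorem L₃PC_complete_of_s_notMem {v : List Letter} (hv : ∀ l ∈ v, l = .b ∨ l = .c)
    {α : List L₃PC.NT} (hs : Letter.s ∉ α) (h₀ : α.count .b = 0 ∨ α.count .c = 0)
    (hb : v.count .b = α.count .a + α.count .b) (hc : v.count .c = α.count .a + α.count .c) :
    Derives L₃PC.Step α v [] := by
  have split {x : Letter} {α : List Letter} (hs : Letter.s ∉ α) (h : 0 < α.count x) :
      ∃ β γ, α = β ++ x :: γ ∧ ∀ y ∈ β, dependenceClass y ≠ dependenceClass x := by
    have hx := count_pos_iff.1 h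
    obtain ⟨β, γ, rfl, hβ⟩ := eq_append_cons_of_mem hx
    refine ⟨β, γ, rfl, fun y hy e => ?_⟩
    have : y ≠ x := fun e => hβ (e ▸ hy)
    have : y ≠ .s := fun e => hs (by simp [← e, hy])
    have : x ≠ .s := fun e => hs (e ▸ hx)
    -- Without s the map `dependenceClass` is injective on what remains.
    cases x <;> cases y <;> simp_all [dependenceClass]
  induction v generalizing α with
  | nil =>
    cases α with
    | nil => exact .nil _
    | cons x α => cases x <;> simp at hb hc hs; omega
  | cons x v ih =>
    have hv' : ∀ l ∈ v, l = .b ∨ l = .c := fun l hl => hv l (mem_cons_of_mem x hl)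
    rcases hv x mem_cons_self with rfl | rfl
    · by_cases h : 0 < α.count .b
      · obtain ⟨β, γ, rfl, hβ⟩ := split hs h
        refine PCGrammar.derives_cons_of_independent (.inr (.inr (.inr (.inr (.inl rfl))))) hβ
          (ih hv' ?_ ?_ ?_ ?_) <;> simp at * <;> grind
      · obtain ⟨β, γ, rfl, hβ⟩ := split (x := .a) hs (by simp at hb; omega)
        refine PCGrammar.derives_cons_of_independent (.inr (.inr (.inl rfl))) hβ
          (ih hv' ?_ ?_ ?_ ?_) <;> simp at * <;> grind
    · by_cases h : 0 < α.count .c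
      · obtain ⟨β, γ, rfl, hβ⟩ := split hs h
        refine PCGrammar.derives_cons_of_independent (.inr (.inr (.inr (.inr (.inr rfl))))) hβ
          (ih hv' ?_ ?_ ?_ ?_) <;> simp at * <;> grind
      · obtain ⟨β, γ, rfl, hβ⟩ := split (x := .a) hs (by simp at hc; omega)
        refine PCGrammar.derives_cons_of_independent (.inr (.inr (.inr (.inl rfl)))) hβ
          (ih hv' ?_ ?_ ?_ ?_) <;> simp at * <;> grind

theorem L₃PC_complete {k m : ℕ} {v : List Letter} (hv : ∀ l ∈ v, l = .b ∨ l = .c)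
    (hb : v.count .b = k + m) (hc : v.count .c = k + m) :
    Derives L₃PC.Step (.s :: replicate k .a) (replicate m .a ++ .s :: v) [] := by
  induction m generalizing k with
  | zero =>
    have h : (Letter.s, Letter.s, []) ∈ L₃PC.productions := .inr (.inl rfl)
    exact .cons (u := [.s]) (.production _ h) (L₃PC_complete_of_s_notMem (α := replicate k .a) hv
      (by simp [mem_replicate]) (by simp [count_replicate]) (by simp [count_replicate, hb])
      (by simp [count_replicate, hc]))
  | succ m ih =>
    have h : (Letter.s, Letter.a, [.s, .a]) ∈ L₃PC.productions := .inl rfl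
    exact .cons (u := [.a]) (.production _ h) (ih (k := k + 1) (by omega) (by omega))

theorem L₃_mem_trPCCFL : L₃ ∈ TrPCCFL Letter := by
  refine ⟨L₃PC, fun X Y Z h₁ h₂ => ?_, Set.ext fun w => ⟨fun h => ?_, fun h => ?_⟩⟩
  · exact not_not.2 ((not_not.1 h₁).trans (not_not.1 h₂))
  · obtain ⟨m, v, hv, hb, hc, rfl⟩ := L₃PC_sound (k := 0) h rfl rfl
    exact mem_L₃_iff_count.2 ⟨m, v, hv, by omega, by omega, rfl⟩
  · obtain ⟨n, v, hv, hb, hc, rfl⟩ := mem_L₃_iff_count.1 h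
    exact L₃PC_complete (k := 0) hv (by omega) (by omega)

end PartialComm

theorem mainTheorem2 :
    (∃ (T : Type) (_ : Finite T),
      ¬ (PartialComm.TrPCCFL T ∩ PartialComm.ShuffleCFL T ⊆ PartialComm.TraceCFL T)) ∧
    (∃ (T : Type) (_ : Finite T),
      ¬ (PartialComm.TrPCCFL T ∩ PartialComm.TraceCFL T ⊆ PartialComm.ShuffleCFL T)) ∧
    (PartialComm.L₃ ∈ PartialComm.TrPCCFL PartialComm.Letter ∩
        PartialComm.TraceCFL PartialComm.Letter ∧
      PartialComm.L₃ ∉ PartialComm.ShuffleCFL PartialComm.Letter) := by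
  have h₃ := And.intro PartialComm.L₃_mem_trPCCFL PartialComm.L₃_mem_traceCFL
  exact ⟨⟨PartialComm.Letter, inferInstance, fun h => PartialComm.shuffledABC_notMem_traceCFL
      (h ⟨PartialComm.shuffledABC_mem_trPCCFL, PartialComm.shuffledABC_mem_shuffleCFL⟩)⟩,
    ⟨PartialComm.Letter, inferInstance, fun h => PartialComm.L₃_notMem_shuffleCFL (h h₃)⟩,
    h₃, PartialComm.L₃_notMem_shuffleCFL⟩
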